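/- **Notation.** $\mathbb N=\{1,2,\dots\}$; $c_{00}(\mathbb N)$ is the space of finitely supported $x:\mathbb N\to\mathbb R$, with standard basis $(e_n)_n$. Elements $f\in c_{00}(\mathbb N)$ also act as functionals by $f(x)=\sum_n f(n)x(n)$, and $e_n^*$ denotes $e_n$ used in this way. For nonzero $x,y$ write $x<y$ if $\max\operatorname{supp}x<\min\operatorname{supp}y$; a block sequence is a sequence of nonzero vectors with $x_1<x_2<\cdots$. For an interval $E$, $Ef=f\cdot\chi_E$. Let $m_1=2^8$, $m_{j+1}=m_j^5$, $n_1=2^7$, $n_{j+1}=(2n_j)^{s_{j+1}}$ with $s_{j+1}=\log_2(m_{j+1}^4)$. **The set $G_0$.** $G_0$ is the minimal subset of $c_{00}(\mathbb N)$ such that: (1) $e_n^*\in G_0$ for all $n$; (2) $-f\in G_0$ for $f\in G_0$; (3) $\frac1{m_{2j}}\sum_{i=1}^d f_i\in G_0$ whenever $j\in\mathbb N$, $d\le n_{2j}$ and $f_1<\dots<f_d$ are in $G_0$; a functional of this form is said to have weight $w(f)=m_{2j}$ (a functional may have several weights); (4) $\sum_{i=1}^d a_if_i\in G_0$ whenever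 $a_i\in\mathbb Q$, $\sum_{i=1}^d a_i^2\le1$ and $f_1,\dots,f_d\in G_0$ have pairwise different weights (i.e. have weights that are pairwise different). **The set $W_0$.** Let $\Omega_1,\Omega_2$ be disjoint infinite subsets of $\mathbb N$, let $Q_s$ be the set of finite sequences $(f_1,\dots,f_d)$, $d\ge1$, of nonzero elements of $G_0$ with $f_1<\dots<f_d$, and let $\sigma:Q_s\to\{2j:j\in\Omega_2\}$ be injective with $$m_{\sigma(f_1,\dots,f_d)}>\max\Big\{\tfrac1{|f_i(e_l)|}:1\le i\le d,\ l\in\operatorname{supp}f_i\Big\}\cdot\max\operatorname{supp}f_d .$$ For $j\in\mathbb N$, a sequence $(f_i)_{i=1}^{n_{2j+1}}\in Q_s$ is a $\sigma$-$n_{2j+1}$ special sequence if $f_1$ has weight $m_{2j_1}$ for some $j_1\in\Omega_1$ with $n_{2j+1}^2<m_{2j_1}$, and $f_{i+1}$ has weight $m_{\sigma(f_1,\dots,f_i)}$ for $1\le i<n_{2j+1}$. Let $W_0$ be the minimal subset of $c_{00}(\mathbb N)$ that contains $G_0$ and all $\frac1{m_{2j+1}}\sum_{i=1}^{n_{2j+1}}f_i$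 with $j\in\mathbb N$ and $(f_i)_{i=1}^{n_{2j+1}}$ a $\sigma$-$n_{2j+1}$ special sequence, is symmetric ($f\in W_0\Rightarrow -f\in W_0$), and is closed under restrictions $f\mapsto Ef$ to finite intervals $E$ of $\mathbb N$. For $x\in c_{00}(\mathbb N)$ put $\|x\|_{G_0}=\sup_{f\in G_0}|f(x)|$ and $\|x\|_{W_0}=\sup_{f\in W_0}|f(x)|$. **Proposition 4.1.** Let $\Omega_1,\Omega_2,\sigma$ be as above. For every $\varepsilon>0$ there is $n\in\mathbb N$ such that for every $k>n$ and every block sequence $(x_i)_{i\in\mathbb N}$ in $c_{00}(\mathbb N)$ with $\varepsilon<\|x_i\|_{G_0}\le\|x_i\|_{W_0}\le1$ for all $i$, there is an infinite set $L\subseteq\mathbb N$ such that for all $n_1<\dots<n_k$ in $L$: $$\phi\Big(\frac{x_{n_1}+\dots+x_{n_k}}k\Big)\le\Big\|\frac{x_{n_1}+\dots+x_{n_k}}k\Big\|_{G_0}\quad\text{for every }\phi\in W_0\setminus G_0,$$ and hence $$\Big\|\frac{x_{n_1}+\dots+x_{n_k}}k\Big\|_{W_0}=\Big\|\frac{x_{n_1}+\dots+x_{n_k}}k\Big\|_{G_0}.$$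 -/

import Mathlib

namespace C0Saturated

noncomputable section

/-- The space `c₀₀(ℕ)`, with `ℕ = {1, 2, …}` as the index set of the coordinates. Its elements serve
both as vectors and as functionals. -/
abbrev C00 : Type := ℕ+ →₀ ℝ

/-- The action of `f ∈ c₀₀(ℕ)` on `x ∈ c₀₀(ℕ)` through the usual inner product. -/
def act (f x : C00) : ℝ := f.sum fun l c => c * x l

/-- The norm induced by a norming set `S`: `‖x‖_S = sup {|f(x)| : f ∈ S}`. -/
def normOf (S : Set C00) (x : C00) : ℝ := sSup ((fun f => |act f x|) '' S)

/-- The relation `f < g`: the support of `f` lies to the left of the support of `g`. The zero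
vector compares with everything; where this matters, `≠ 0` is required separately. -/
def Before (f g : C00) : Prop := ∀ a ∈ f.support, ∀ b ∈ g.support, a < b

/-- The restriction `E f` of `f` to the interval `E = [a, b]`. -/
def restrict (a b : ℕ+) (f : C00) : C00 := f.filter fun l => a ≤ l ∧ l ≤ b

/-- `m₁ = 2⁸`, `m_{j+1} = m_j⁵`. The value at `0` is never used. -/
def m : ℕ → ℕ
  | 0 => 1
  | 1 => 2 ^ 8
  | j + 2 => m (j + 1) ^ 5

/-- `n₁ = 2⁷`, `n_{j+1} = (2 n_j) ^ s_{j+1}` with `s_{j+1} = log₂ (m_{j+1}⁴)` (an exact logarithm,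
since `m_{j+1}` is a power of two). The value at `0` is never used. -/
def n : ℕ → ℕ
  | 0 => 1
  | 1 => 2 ^ 7
  | j + 2 => (2 * n (j + 1)) ^ Nat.log 2 (m (j + 2) ^ 4)

/-- Relative to the set `S`, the functional `f` has weight `m_i`, where `i = 2j`, `j ≥ 1`:
`f = (1 / m_i) (f₁ + ⋯ + f_d)` with `d ≤ n_i` and `f₁ < ⋯ < f_d` in `S`. One functional may have
several weights. Vanishing terms add nothing to the sum, so they need not be excluded. -/
def HasWeight (S : Set C00) (i : ℕ) (f : C00) : Prop :=
  (∃ j, 1 ≤ j ∧ i = 2 * j) ∧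
    ∃ l : List C00, l.length ≤ n i ∧ (∀ g ∈ l, g ∈ S) ∧ l.Pairwise Before ∧
      f = (m i : ℝ)⁻¹ • l.sum

/-- The closure properties that define `G₀`. -/
structure IsG0Closed (S : Set C00) : Prop where
  basis : ∀ l : ℕ+, Finsupp.single l (1 : ℝ) ∈ S
  symm : ∀ f ∈ S, -f ∈ S
  even_op : ∀ i f, HasWeight S i f → f ∈ S
  /-- Closure under `∑ a_r f_r` with `a_r` rational, `∑ a_r² ≤ 1`, and the `f_r` in `S` having
  pairwise different weights `m_{i_r}`. -/
  l2_op : ∀ (d : ℕ) (a : Fin d → ℚ) (f : Fin d → C00) (i : Fin d → ℕ),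
    ∑ r, a r ^ 2 ≤ 1 → (∀ r, f r ∈ S) → (∀ r, HasWeight S (i r) (f r)) →
      Function.Injective i → ∑ r, (a r : ℝ) • f r ∈ S

/-- The norming set `G₀`: the minimal subset of `c₀₀(ℕ)` with the above closure properties. -/
def G0 : Set C00 := ⋂₀ {S | IsG0Closed S}

/-- `Q_s`: the nonempty finite sequences `f₁ < ⋯ < f_d` of nonzero elements of `G₀`. -/
def Qs : Set (List C00) :=
  {s | s ≠ [] ∧ (∀ f ∈ s, f ∈ G0 ∧ f ≠ 0) ∧ s.Pairwise Before}

/-- The data of the coding: `Ω₁`, `Ω₂` are disjoint infinite subsets of `{1, 2, …}` and `σ` is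
an injective map from `Q_s` to `{2j : j ∈ Ω₂}` such that
`m_{σ(f₁,…,f_d)} > max {1 / |f_i(e_l)| : i ≤ d, l ∈ supp f_i} · max supp f_d`.
The values of `σ` off `Q_s` are irrelevant. -/
structure IsCoding (Ω₁ Ω₂ : Set ℕ) (σ : List C00 → ℕ) : Prop where
  infinite₁ : Ω₁.Infinite
  infinite₂ : Ω₂.Infinite
  pos₁ : ∀ j ∈ Ω₁, 1 ≤ j
  pos₂ : ∀ j ∈ Ω₂, 1 ≤ j
  disjoint : Disjoint Ω₁ Ω₂
  injOn : Set.InjOn σ Qs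
  mem : ∀ s ∈ Qs, ∃ j ∈ Ω₂, σ s = 2 * j
  growth : ∀ s ∈ Qs, ∀ f ∈ s, ∀ l ∈ f.support, ∀ g ∈ s.getLast?, ∀ b ∈ g.support,
    1 / |f l| * ((b : ℕ) : ℝ) < (m (σ s) : ℝ)

/-- The sequence `s = (f₁, …, f_N)`, `N = n_{2j+1}`, is a `σ-n_{2j+1}` special sequence: it lies in
`Q_s`, `f₁` has weight `m_{2j₁}` for some `j₁ ∈ Ω₁` with `n_{2j+1}² < m_{2j₁}`, and `f_{i+1}` has
weight `m_{σ(f₁,…,f_i)}` for `1 ≤ i < N`. In particular every `f_i` has a weight. -/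
def IsSpecial (Ω₁ : Set ℕ) (σ : List C00 → ℕ) (j : ℕ) (s : List C00) : Prop :=
  s ∈ Qs ∧ s.length = n (2 * j + 1) ∧
    (∃ j₁ ∈ Ω₁, n (2 * j + 1) ^ 2 < m (2 * j₁) ∧
      ∃ f ∈ s.head?, HasWeight G0 (2 * j₁) f) ∧
    ∀ (i : ℕ) (_ : 1 ≤ i) (h : i < s.length), HasWeight G0 (σ (s.take i)) s[i]

/-- The closure properties that define `W₀`. -/
structure IsW0Closed (Ω₁ : Set ℕ) (σ : List C00 → ℕ) (S : Set C00) : Prop where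
  subset : G0 ⊆ S
  special : ∀ j s, 1 ≤ j → IsSpecial Ω₁ σ j s → (m (2 * j + 1) : ℝ)⁻¹ • s.sum ∈ S
  symm : ∀ f ∈ S, -f ∈ S
  restrict : ∀ (a b : ℕ+), ∀ f ∈ S, restrict a b f ∈ S

/-- The norming set `W₀`: the minimal subset of `c₀₀(ℕ)` with the above closure properties. -/
def W0 (Ω₁ : Set ℕ) (σ : List C00 → ℕ) : Set C00 := ⋂₀ {S | IsW0Closed Ω₁ σ S}

/-- A block sequence: nonzero vectors with `x₀ < x₁ < x₂ < ⋯`. -/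
def IsBlock (x : ℕ → C00) : Prop := (∀ i, x i ≠ 0) ∧ ∀ i, Before (x i) (x (i + 1))

theorem HasWeight.mono {S T : Set C00} (h : S ⊆ T) {i : ℕ} {f : C00} (hf : HasWeight S i f) :
    HasWeight T i f := by
  obtain ⟨hi, l, h1, h2, h3, h4⟩ := hf
  exact ⟨hi, l, h1, fun g hg => h (h2 g hg), h3, h4⟩

/-- `G₀` itself has the closure properties, so it is their least solution. -/
theorem isG0Closed_G0 : IsG0Closed G0 where
  basis l := fun _ hS => hS.basis l
  symm f hf := fun S hS => hS.symm f (hf S hS)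
  even_op i f hf := fun _ hS => hS.even_op i f (hf.mono (Set.sInter_subset_of_mem hS))
  l2_op d a f i ha hf hw hi := fun S hS =>
    hS.l2_op d a f i ha (fun r => hf r S hS)
      (fun r => (hw r).mono (Set.sInter_subset_of_mem hS)) hi

/-- `W₀` itself has the closure properties, so it is their least solution. -/
theorem isW0Closed_W0 (Ω₁ : Set ℕ) (σ : List C00 → ℕ) : IsW0Closed Ω₁ σ (W0 Ω₁ σ) where
  subset := fun _ hf _ hS => hS.subset hf
  special j s hj hs := fun _ hS => hS.special j s hj hs
  symm f hf := fun S hS => hS.symm f (hf S hS)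
  restrict a b f hf := fun S hS => hS.restrict a b f (hf S hS)

theorem one_le_m (j : ℕ) : 1 ≤ m j := by
  induction j using m.induct with
  | case1 => simp [m]
  | case2 => simp [m]
  | case3 j ih => rw [m]; exact Nat.one_le_pow _ _ ih

theorem two_pow_le_m (j : ℕ) : 2 ^ j ≤ m j := by
  induction j using m.induct with
  | case1 => simp [m]
  | case2 => simp [m]
  | case3 j ih =>
    rw [m]
    have h2 : 2 ≤ m (j + 1) := le_trans (by rw [pow_succ]; have := Nat.one_le_two_pow (n := j); omega) ih
    calc 2 ^ (j + 2) = 2 ^ (j + 1) * 2 := by ring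
      _ ≤ m (j + 1) * m (j + 1) := Nat.mul_le_mul ih h2
      _ = m (j + 1) ^ 2 := by ring
      _ ≤ m (j + 1) ^ 5 := Nat.pow_le_pow_right (by omega) (by norm_num)

/-- At each coordinate at most one term of a sum `f₁ + ⋯ + f_d` with `f₁ < ⋯ < f_d` is nonzero. -/
theorem abs_sum_le {s : List C00} {c : ℝ} (hc : 0 ≤ c) (hs : s.Pairwise Before) (l : ℕ+)
    (h : ∀ f ∈ s, |f l| ≤ c) : |s.sum l| ≤ c := by
  induction s with
  | nil => simpa using hc
  | cons f s ih =>
    rw [List.pairwise_cons] at hs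
    rw [List.sum_cons, Finsupp.add_apply]
    by_cases hf : f l = 0
    · rw [hf, zero_add]
      exact ih hs.2 fun g hg => h g (List.mem_cons_of_mem _ hg)
    · have h0 : ∀ g ∈ s, g l = 0 := by
        intro g hg
        by_contra hgl
        exact lt_irrefl l (hs.1 g hg l (Finsupp.mem_support_iff.2 hf) l
          (Finsupp.mem_support_iff.2 hgl))
      have h1 : ∀ t : List C00, (∀ g ∈ t, g l = 0) → t.sum l = 0 := by
        intro t
        induction t with
        | nil => simp
        | cons g t iht =>
          intro ht
          rw [List.sum_cons, Finsupp.add_apply, ht g (by simp),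
            iht fun g hg => ht g (List.mem_cons_of_mem _ hg), add_zero]
      rw [h1 s h0, add_zero]
      exact h f (by simp)

theorem HasWeight.abs_le {S : Set C00} (hS : ∀ f ∈ S, ∀ l, |f l| ≤ 1) {i : ℕ} {f : C00}
    (hf : HasWeight S i f) (l : ℕ+) : |f l| ≤ (1 / 2) ^ i := by
  obtain ⟨-, s, -, h2, h3, rfl⟩ := hf
  have h := abs_sum_le zero_le_one h3 l fun g hg => hS g (h2 g hg) l
  have hm : ((2 : ℝ) ^ i) ≤ m i := by exact_mod_cast two_pow_le_m i
  have hp : (0 : ℝ) < 2 ^ i := by positivity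
  rw [Finsupp.smul_apply, smul_eq_mul, abs_mul, abs_of_nonneg (by positivity)]
  calc (m i : ℝ)⁻¹ * |s.sum l| ≤ (2 ^ i)⁻¹ * 1 := by gcongr
    _ = (1 / 2) ^ i := by simp

theorem isG0Closed_abs_le : IsG0Closed {f | ∀ l, |f l| ≤ 1} where
  basis l k := by
    classical
    rw [Finsupp.single_apply]
    split <;> simp
  symm f hf l := by simpa using hf l
  even_op i f hf l :=
    (hf.abs_le (fun f hf => hf) l).trans (pow_le_one₀ (by norm_num) (by norm_num))
  l2_op d a f i ha _ hw hi l := by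
    rw [Finsupp.finsetSum_apply]
    simp only [Finsupp.smul_apply, smul_eq_mul]
    have h1 : ∑ r, (a r : ℝ) ^ 2 ≤ 1 := by exact_mod_cast ha
    have hb : ∀ r, f r l ^ 2 ≤ (1 / 4 : ℝ) ^ i r := by
      intro r
      have := (hw r).abs_le (fun f hf => hf) l
      calc f r l ^ 2 = |f r l| ^ 2 := (sq_abs _).symm
        _ ≤ ((1 / 2) ^ i r) ^ 2 := by gcongr
        _ = (1 / 4) ^ i r := by rw [← pow_mul, mul_comm, pow_mul]; norm_num
    have hi1 : ∀ r, 1 ≤ i r := fun r => by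
      obtain ⟨⟨j, hj, h⟩, -⟩ := hw r
      omega
    have h2 : ∑ r, f r l ^ 2 ≤ 1 := by
      have hsum : Summable fun t : ℕ => (1 / 4 : ℝ) * (1 / 4) ^ t :=
        (summable_geometric_of_lt_one (by norm_num) (by norm_num)).mul_left _
      have hinj : Function.Injective fun r => i r - 1 := by
        intro r r' h
        have h := h
        have := hi1 r
        have := hi1 r'
        apply hi
        simp only at h
        omega
      calc ∑ r, f r l ^ 2 ≤ ∑ r, (1 / 4 : ℝ) * (1 / 4) ^ (i r - 1) := by
            refine Finset.sum_le_sum fun r _ => (hb r).trans (le_of_eq ?_)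
            rw [← pow_succ', Nat.sub_add_cancel (hi1 r)]
        _ = ∑ t ∈ Finset.univ.map ⟨_, hinj⟩, (1 / 4 : ℝ) * (1 / 4) ^ t := by
            rw [Finset.sum_map]; rfl
        _ ≤ ∑' t : ℕ, (1 / 4 : ℝ) * (1 / 4) ^ t :=
            hsum.sum_le_tsum _ fun _ _ => by positivity
        _ ≤ 1 := by
            rw [tsum_mul_left, tsum_geometric_of_lt_one (by norm_num) (by norm_num)]
            norm_num
    refine abs_le_one_iff_mul_self_le_one.2 ?_
    have h3 := Finset.sum_mul_sq_le_sq_mul_sq Finset.univ (fun r => (a r : ℝ)) (fun r => f r l)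
    have h4 : (0 : ℝ) ≤ ∑ r, f r l ^ 2 := Finset.sum_nonneg fun _ _ => sq_nonneg _
    nlinarith

theorem abs_le_one_of_mem_G0 {f : C00} (hf : f ∈ G0) (l : ℕ+) : |f l| ≤ 1 :=
  hf _ isG0Closed_abs_le l

theorem abs_le_one_of_mem_W0 {Ω₁ : Set ℕ} {σ : List C00 → ℕ} {f : C00} (hf : f ∈ W0 Ω₁ σ)
    (l : ℕ+) : |f l| ≤ 1 := by
  refine hf {f | ∀ l, |f l| ≤ 1} ⟨fun f hf l => abs_le_one_of_mem_G0 hf l, ?_, ?_, ?_⟩ l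
  · intro j s _ hs l
    have h := abs_sum_le zero_le_one hs.1.2.2 l fun f hf => abs_le_one_of_mem_G0 (hs.1.2.1 f hf).1 l
    have hm : (1 : ℝ) ≤ m (2 * j + 1) := by exact_mod_cast one_le_m _
    rw [Finsupp.smul_apply, smul_eq_mul, abs_mul, abs_of_nonneg (by positivity)]
    exact mul_le_one₀ (inv_le_one_of_one_le₀ hm) (abs_nonneg _) h
  · intro f hf l
    simpa using hf l
  · intro a b f hf l
    rw [C0Saturated.restrict, Finsupp.filter_apply]
    split
    · exact hf l
    · simp

/-- The supremum in `normOf (W0 Ω₁ σ) x`, hence also that in `normOf G0 x`, is finite. -/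
theorem bddAbove_act_W0 (Ω₁ : Set ℕ) (σ : List C00 → ℕ) (x : C00) :
    BddAbove ((fun f => |act f x|) '' W0 Ω₁ σ) := by
  refine ⟨∑ l ∈ x.support, |x l|, ?_⟩
  rintro _ ⟨f, hf, rfl⟩
  have h : act f x = ∑ l ∈ x.support, f l * x l := by
    classical
    rw [act, Finsupp.sum]
    rw [Finset.sum_subset (Finset.subset_union_left (s₂ := x.support))
      (fun l _ hl => by simp [Finsupp.notMem_support_iff.1 hl])]
    exact (Finset.sum_subset Finset.subset_union_right
      (fun l _ hl => by simp [Finsupp.notMem_support_iff.1 hl])).symm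
  simp only [h]
  refine (Finset.abs_sum_le_sum_abs _ _).trans (Finset.sum_le_sum fun l _ => ?_)
  rw [abs_mul]
  exact mul_le_of_le_one_left (abs_nonneg _) (abs_le_one_of_mem_W0 hf l)

end

end C0Saturated

namespace C0Saturated

/-! Up to sign, an element of W₀ outside G₀ is `m (2 * j + 1)`⁻¹ g, where g is a restriction of the
sum of a special sequence of length N = `n (2 * j + 1)`. Let y be the sum of the k chosen vectors.
For large k, averaging norming functionals with an even weight gives ‖y‖_{G₀} ≥ 6
(`exists_threshold`, `IsBlock.le_normOf_sum`). As `m (2 * j + 1)` ≥ 4, it then suffices that |g(y)|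
≤ 2‖y‖_{G₀} + 2 `m (2 * j + 1)` + 4, which is arranged by choosing the subsequence.

Two mechanisms give this bound. On a fixed vector, g is negligible once N is large compared with the
ℓ₁-norm, since its terms have coordinates at most N⁻². For fixed j, only boundedly many weights are
large on each x_i, by the ℓ₂-operation, and injectivity of σ lets a weight determine the terms
preceding it. A Δ-system argument makes the histories of weights seen by different vectors meet only
in a finite set R, and dropping initial vectors puts the histories coded by R to the left of all x_i
(`exists_separated`). Then all but two terms of the special sequence see at most one common vector;
each exceptional term costs one G₀-norm.

Diagonalization handles all j at once: the vectors after x_i are separated for the finitely many j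
for which x_i is not negligible. Given j, the vectors before the first non-negligible one contribute
at most 1 in total, that one contributes at most `m (2 * j + 1)`, and the later ones are separated.
-/

/-! ### The pairing and coordinate restrictions -/

theorem act_eq_linearCombination (f x : C00) : act f x = Finsupp.linearCombination ℝ (⇑x) f := rfl

theorem act_comm (f x : C00) : act f x = act x f := by
  classical
  have h : ∀ f x : C00, act f x = ∑ l ∈ f.support ∪ x.support, f l * x l := fun f x => by
    rw [act, Finsupp.sum]
    exact Finset.sum_subset Finset.subset_union_left fun l _ hl => by
      simp [Finsupp.notMem_support_iff.1 hl]
  rw [h f x, h x f, Finset.union_comm]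
  exact Finset.sum_congr rfl fun l _ => mul_comm _ _

theorem act_neg_left (f x : C00) : act (-f) x = -act f x := by
  simp only [act_eq_linearCombination, map_neg]

theorem act_smul_left (c : ℝ) (f x : C00) : act (c • f) x = c * act f x := by
  simp only [act_eq_linearCombination, map_smul, smul_eq_mul]

theorem act_sum_left {ι : Type*} (s : Finset ι) (f : ι → C00) (x : C00) :
    act (∑ i ∈ s, f i) x = ∑ i ∈ s, act (f i) x := by
  simp only [act_eq_linearCombination, map_sum]

theorem act_smul_right (c : ℝ) (f x : C00) : act f (c • x) = c * act f x := by
  rw [act_comm, act_smul_left, act_comm]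

theorem act_sum_right {ι : Type*} (s : Finset ι) (f : C00) (x : ι → C00) :
    act f (∑ i ∈ s, x i) = ∑ i ∈ s, act f (x i) := by
  rw [act_comm, act_sum_left]
  exact Finset.sum_congr rfl fun i _ => act_comm _ _

theorem act_eq_sum_support (f x : C00) : act f x = ∑ l ∈ x.support, f l * x l := by
  rw [act_comm, act, Finsupp.sum]
  exact Finset.sum_congr rfl fun l _ => mul_comm _ _

/-- The `ℓ₁`-norm on `c₀₀(ℕ)`. -/
def l1norm (x : C00) : ℝ := ∑ l ∈ x.support, |x l|

theorem abs_act_le_l1norm {f : C00} {c : ℝ} (hf : ∀ l, |f l| ≤ c) (x : C00) :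
    |act f x| ≤ c * l1norm x := by
  rw [act_eq_sum_support, l1norm, Finset.mul_sum]
  refine (Finset.abs_sum_le_sum_abs _ _).trans (Finset.sum_le_sum fun l _ => ?_)
  rw [abs_mul]
  exact mul_le_mul_of_nonneg_right (hf l) (abs_nonneg _)

open Classical in
/-- The restriction of a vector to a set of coordinates. -/
noncomputable def cut (A : Set ℕ+) : C00 →ₗ[ℝ] C00 where
  toFun f := f.filter (· ∈ A)
  map_add' _ _ := Finsupp.filter_add
  map_smul' _ _ := Finsupp.filter_smul

theorem cut_apply_of_mem {A : Set ℕ+} {l : ℕ+} (h : l ∈ A) (f : C00) : cut A f l = f l := by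
  classical
  simp [cut, h]

theorem cut_apply_of_notMem {A : Set ℕ+} {l : ℕ+} (h : l ∉ A) (f : C00) : cut A f l = 0 := by
  classical
  simp [cut, h]

theorem abs_cut_apply_le (A : Set ℕ+) (f : C00) (l : ℕ+) : |cut A f l| ≤ |f l| := by
  by_cases h : l ∈ A
  · rw [cut_apply_of_mem h]
  · rw [cut_apply_of_notMem h, abs_zero]
    exact abs_nonneg _

theorem cut_cut (A B : Set ℕ+) (f : C00) : cut A (cut B f) = cut (A ∩ B) f := by
  ext l
  by_cases hA : l ∈ A
  · rw [cut_apply_of_mem hA]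
    by_cases hB : l ∈ B
    · rw [cut_apply_of_mem hB, cut_apply_of_mem (Set.mem_inter hA hB)]
    · rw [cut_apply_of_notMem hB, cut_apply_of_notMem fun h => hB h.2]
  · rw [cut_apply_of_notMem hA, cut_apply_of_notMem fun h => hA h.1]

theorem cut_univ (f : C00) : cut Set.univ f = f := by
  ext l
  rw [cut_apply_of_mem (Set.mem_univ l)]

theorem restrict_eq_cut (a b : ℕ+) (f : C00) : restrict a b f = cut (Set.Icc a b) f := by
  ext l
  rw [restrict, Finsupp.filter_apply]
  split_ifs with h
  · rw [cut_apply_of_mem h]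
  · rw [cut_apply_of_notMem h]

theorem mem_of_cut_ne_zero {A : Set ℕ+} {f : C00} {l : ℕ+} (h : cut A f l ≠ 0) :
    l ∈ A ∧ f l ≠ 0 := by
  by_cases hA : l ∈ A
  · exact ⟨hA, by rwa [cut_apply_of_mem hA] at h⟩
  · exact absurd (cut_apply_of_notMem hA f) h

theorem Before.cut {f g : C00} (h : Before f g) (A B : Set ℕ+) : Before (cut A f) (cut B g) :=
  fun a ha b hb =>
    h a (Finsupp.mem_support_iff.2 (mem_of_cut_ne_zero (Finsupp.mem_support_iff.1 ha)).2)
      b (Finsupp.mem_support_iff.2 (mem_of_cut_ne_zero (Finsupp.mem_support_iff.1 hb)).2)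

theorem act_cut_eq_zero {f x : C00} {A : Set ℕ+} (h : ∀ l ∈ A, f l ≠ 0 → x l = 0) :
    act (cut A f) x = 0 := by
  rw [act_eq_sum_support]
  refine Finset.sum_eq_zero fun l hl => mul_eq_zero_of_left ?_ _
  by_contra hne
  have := mem_of_cut_ne_zero hne
  exact Finsupp.mem_support_iff.1 hl (h l this.1 this.2)

theorem act_cut_eq {f x : C00} {A : Set ℕ+} (h : ∀ l, x l ≠ 0 → l ∈ A) :
    act (cut A f) x = act f x := by
  rw [act_eq_sum_support, act_eq_sum_support]
  exact Finset.sum_congr rfl fun l hl => by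
    rw [cut_apply_of_mem (h l (Finsupp.mem_support_iff.1 hl))]

theorem Before.act_cut_eq_zero {f x : C00} (h : Before f x) (A : Set ℕ+) :
    act (C0Saturated.cut A f) x = 0 :=
  C0Saturated.act_cut_eq_zero fun l _ hl => by
    by_contra hx
    exact lt_irrefl l (h l (Finsupp.mem_support_iff.2 hl) l (Finsupp.mem_support_iff.2 hx))

theorem HasWeight.cut {S : Set C00} (A : Set ℕ+) (hS : ∀ f ∈ S, C0Saturated.cut A f ∈ S) {i : ℕ}
    {f : C00} (hf : HasWeight S i f) : HasWeight S i (C0Saturated.cut A f) := by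
  obtain ⟨hi, s, h1, h2, h3, rfl⟩ := hf
  refine ⟨hi, s.map (C0Saturated.cut A), by simpa using h1, ?_, ?_, ?_⟩
  · intro g hg
    obtain ⟨g', hg', rfl⟩ := List.mem_map.1 hg
    exact hS g' (h2 g' hg')
  · exact h3.map _ fun _ _ h => h.cut A A
  · rw [map_smul, map_list_sum]

theorem HasWeight.neg {S : Set C00} (hS : ∀ f ∈ S, -f ∈ S) {i : ℕ}
    {f : C00} (hf : HasWeight S i f) : HasWeight S i (-f) := by
  obtain ⟨hi, s, h1, h2, h3, rfl⟩ := hf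
  refine ⟨hi, s.map (-LinearMap.id : C00 →ₗ[ℝ] C00), by simpa using h1, ?_, ?_, ?_⟩
  · intro g hg
    obtain ⟨g', hg', rfl⟩ := List.mem_map.1 hg
    exact hS g' (h2 g' hg')
  · refine h3.map _ fun f g h => ?_
    simpa [Before] using h
  · rw [← map_list_sum]
    simp

/-! ### Structure of G₀ and W₀ -/

theorem zero_mem_G0 : (0 : C00) ∈ G0 :=
  isG0Closed_G0.even_op 2 0 ⟨⟨1, le_rfl, rfl⟩, [], by simp, by simp, by simp, by simp⟩

/-- `G₀` is closed under restriction to arbitrary sets of coordinates. -/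
theorem cut_mem_G0 (A : Set ℕ+) {f : C00} (hf : f ∈ G0) : cut A f ∈ G0 := by
  have hcl : IsG0Closed {f | f ∈ G0 ∧ cut A f ∈ G0} := by
    have hw : ∀ {i f}, HasWeight {f | f ∈ G0 ∧ cut A f ∈ G0} i f →
        HasWeight G0 i f ∧ HasWeight G0 i (cut A f) := by
      rintro i _ ⟨hi, s, h1, h2, h3, rfl⟩
      refine ⟨⟨hi, s, h1, fun g hg => (h2 g hg).1, h3, rfl⟩,
        hi, s.map (cut A), by simpa using h1, ?_, h3.map _ fun _ _ h => h.cut A A, ?_⟩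
      · intro g hg
        obtain ⟨g', hg', rfl⟩ := List.mem_map.1 hg
        exact (h2 g' hg').2
      · rw [map_smul, map_list_sum]
    refine ⟨?_, ?_, ?_, ?_⟩
    · intro l
      refine ⟨isG0Closed_G0.basis l, ?_⟩
      by_cases h : l ∈ A
      · convert isG0Closed_G0.basis l
        simp [cut, h]
      · convert zero_mem_G0
        simp [cut, h]
    · intro f hf
      refine ⟨isG0Closed_G0.symm f hf.1, ?_⟩
      rw [map_neg]
      exact isG0Closed_G0.symm _ hf.2
    · intro i f hf
      exact ⟨isG0Closed_G0.even_op i f (hw hf).1, isG0Closed_G0.even_op i _ (hw hf).2⟩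
    · intro d a f i ha hf hwf hi
      refine ⟨isG0Closed_G0.l2_op d a f i ha (fun r => (hf r).1) (fun r => (hw (hwf r)).1) hi, ?_⟩
      simp only [map_sum, map_smul]
      exact isG0Closed_G0.l2_op d a _ i ha (fun r => (hf r).2) (fun r => (hw (hwf r)).2) hi
  exact (hf _ hcl).2

theorem HasWeight.abs_le_inv_m {i : ℕ} {f : C00} (hf : HasWeight G0 i f) (l : ℕ+) :
    |f l| ≤ (m i : ℝ)⁻¹ := by
  obtain ⟨-, s, -, h2, h3, rfl⟩ := hf
  rw [Finsupp.smul_apply, smul_eq_mul, abs_mul, abs_of_nonneg (by positivity)]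
  exact mul_le_of_le_one_right (by positivity)
    (abs_sum_le zero_le_one h3 l fun g hg => abs_le_one_of_mem_G0 (h2 g hg) l)

theorem G0_subset_W0 (Ω₁ : Set ℕ) (σ : List C00 → ℕ) : G0 ⊆ W0 Ω₁ σ := (isW0Closed_W0 Ω₁ σ).subset

theorem bddAbove_act_G0 (x : C00) : BddAbove ((fun f => |act f x|) '' G0) :=
  (bddAbove_act_W0 ∅ (fun _ => 0) x).mono (Set.image_mono (G0_subset_W0 _ _))

theorem abs_act_le_normOf_G0 {f : C00} (hf : f ∈ G0) (x : C00) : |act f x| ≤ normOf G0 x :=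
  le_csSup (bddAbove_act_G0 x) ⟨f, hf, rfl⟩

theorem abs_act_le_normOf_W0 {Ω₁ : Set ℕ} {σ : List C00 → ℕ} {f : C00} (hf : f ∈ W0 Ω₁ σ)
    (x : C00) : |act f x| ≤ normOf (W0 Ω₁ σ) x :=
  le_csSup (bddAbove_act_W0 Ω₁ σ x) ⟨f, hf, rfl⟩

theorem exists_mem_G0_lt_act {x : C00} {c : ℝ} (h : c < normOf G0 x) : ∃ f ∈ G0, c < act f x := by
  obtain ⟨_, ⟨f, hf, rfl⟩, hc⟩ :=
    exists_lt_of_lt_csSup (Set.Nonempty.image _ ⟨0, zero_mem_G0⟩) h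
  rcases lt_abs.1 hc with h | h
  · exact ⟨f, hf, h⟩
  · exact ⟨-f, isG0Closed_G0.symm f hf, by rwa [act_neg_left]⟩

/-- An element of `W₀` lies in `G₀` or is, up to sign, a restricted special functional. -/
theorem mem_W0_cases {Ω₁ : Set ℕ} {σ : List C00 → ℕ} {φ : C00} (h : φ ∈ W0 Ω₁ σ) :
    φ ∈ G0 ∨ ∃ (j : ℕ) (s : List C00) (A : Set ℕ+), 1 ≤ j ∧ IsSpecial Ω₁ σ j s ∧
      (φ = cut A ((m (2 * j + 1) : ℝ)⁻¹ • s.sum) ∨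
        φ = -cut A ((m (2 * j + 1) : ℝ)⁻¹ • s.sum)) := by
  refine h {φ | φ ∈ G0 ∨ ∃ (j : ℕ) (s : List C00) (A : Set ℕ+), 1 ≤ j ∧ IsSpecial Ω₁ σ j s ∧
      (φ = cut A ((m (2 * j + 1) : ℝ)⁻¹ • s.sum) ∨
        φ = -cut A ((m (2 * j + 1) : ℝ)⁻¹ • s.sum))} ⟨?_, ?_, ?_, ?_⟩
  · exact fun f hf => Or.inl hf
  · exact fun j s hj hs => Or.inr ⟨j, s, Set.univ, hj, hs, Or.inl (cut_univ _).symm⟩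
  · rintro f (hf | ⟨j, s, A, hj, hs, rfl | rfl⟩)
    · exact Or.inl (isG0Closed_G0.symm f hf)
    · exact Or.inr ⟨j, s, A, hj, hs, Or.inr rfl⟩
    · exact Or.inr ⟨j, s, A, hj, hs, Or.inl (neg_neg _)⟩
  · rintro a b f (hf | ⟨j, s, A, hj, hs, rfl | rfl⟩)
    · exact Or.inl (by rw [restrict_eq_cut]; exact cut_mem_G0 _ hf)
    · exact Or.inr ⟨j, s, Set.Icc a b ∩ A, hj, hs, Or.inl (by rw [restrict_eq_cut, cut_cut])⟩
    · exact Or.inr ⟨j, s, Set.Icc a b ∩ A, hj, hs,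
        Or.inr (by rw [restrict_eq_cut, map_neg, cut_cut])⟩

/-! ### Infinite combinatorics: diagonal sets and Δ-systems -/

/-- Thin M successively for `Q 0`, `Q 1`, …, then pick each new element i' after i from the set
already thinned for `Q i`; since the sets decrease, all later picks lie in it too. -/
theorem exists_infinite_diagonal {M : Set ℕ} (hM : M.Infinite) (Q : ℕ → Set ℕ → Prop)
    (hered : ∀ i A B, A ⊆ B → Q i B → Q i A)
    (ex : ∀ i, ∀ N ⊆ M, N.Infinite → ∃ N' ⊆ N, N'.Infinite ∧ Q i N') :
    ∃ L ⊆ M, L.Infinite ∧ ∀ i ∈ L, Q i {i' ∈ L | i < i'} := by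
  choose! g hgsub hginf hgQ using ex
  let V : ℕ → Set ℕ := fun i => Nat.rec M (fun i N => g i N) i
  have hV : ∀ i, V i ⊆ M ∧ (V i).Infinite := by
    intro i
    induction i with
    | zero => exact ⟨subset_rfl, hM⟩
    | succ i ih => exact ⟨(hgsub i _ ih.1 ih.2).trans ih.1, hginf i _ ih.1 ih.2⟩
  have hanti : Antitone V := antitone_nat_of_succ_le fun i => hgsub i _ (hV i).1 (hV i).2
  have hQ : ∀ i, Q i (V (i + 1)) := fun i => hgQ i _ (hV i).1 (hV i).2
  choose h hhmem hhlt using fun i => (hV (i + 1)).2.exists_gt i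
  let u : ℕ → ℕ := fun t => Nat.rec (h 0) (fun _ i => h i) t
  have humono : StrictMono u := strictMono_nat_of_lt_succ fun t => hhlt (u t)
  have hu : ∀ s t, s < t → u t ∈ V (u s + 1) := by
    intro s t hst
    obtain ⟨t, rfl⟩ : ∃ r, t = r + 1 := ⟨t - 1, by omega⟩
    exact hanti (Nat.succ_le_succ (humono.monotone (Nat.lt_succ_iff.1 hst))) (hhmem (u t))
  refine ⟨Set.range u, ?_, Set.infinite_range_of_injective humono.injective, ?_⟩
  · rintro _ ⟨t, rfl⟩
    cases t with
    | zero => exact (hV (0 + 1)).1 (hhmem 0)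
    | succ t => exact (hV (u t + 1)).1 (hhmem (u t))
  · rintro _ ⟨s, rfl⟩
    refine hered _ _ _ ?_ (hQ (u s))
    rintro _ ⟨⟨t, rfl⟩, hlt⟩
    exact hu s t (humono.lt_iff_lt.1 hlt)

/-- A point lying in infinitely many of the sets can be put into R and erased, lowering the
cardinality bound. If there is none, each set meets only finitely many others, and a diagonal choice
makes them pairwise disjoint. -/
theorem exists_infinite_deltaSystem (K : ℕ) (P : ℕ → Finset ℕ) {M : Set ℕ} (hM : M.Infinite)
    (hP : ∀ i ∈ M, (P i).card ≤ K) :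
    ∃ L ⊆ M, L.Infinite ∧ ∃ R : Finset ℕ, ∀ i ∈ L, ∀ i' ∈ L, i ≠ i' → P i ∩ P i' ⊆ R := by
  induction K generalizing P M with
  | zero =>
    refine ⟨M, subset_rfl, hM, ∅, fun i hi i' _ _ => ?_⟩
    rw [Finset.card_eq_zero.1 (Nat.le_zero.1 (hP i hi)), Finset.empty_inter]
  | succ K ih =>
    by_cases hw : ∃ w, {i ∈ M | w ∈ P i}.Infinite
    · obtain ⟨w, hw⟩ := hw
      obtain ⟨L, hL, hLinf, R, hR⟩ := ih (fun i => (P i).erase w) hw fun i hi => by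
        have := hP i hi.1
        rw [Finset.card_erase_of_mem hi.2]
        omega
      refine ⟨L, fun i hi => (hL hi).1, hLinf, insert w R, fun i hi i' hi' hne v hv => ?_⟩
      by_cases hvw : v = w
      · simp [hvw]
      · rw [Finset.mem_inter] at hv
        refine Finset.mem_insert_of_mem (hR i hi i' hi' hne ?_)
        simp [hvw, hv.1, hv.2]
    · push Not at hw
      obtain ⟨L, hL, hLinf, hdis⟩ := exists_infinite_diagonal hM
        (fun i N => ∀ i' ∈ N, P i ∩ P i' = ∅) (fun i A B hAB h i' hi' => h i' (hAB hi'))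
        (fun i N hN hNinf => ⟨N \ ⋃ w ∈ P i, {i ∈ M | w ∈ P i}, Set.sdiff_subset,
          hNinf.sdiff ((P i).finite_toSet.biUnion fun w _ => hw w), fun i' hi' => by
            rw [Finset.eq_empty_iff_forall_notMem]
            intro w hwi
            rw [Finset.mem_inter] at hwi
            exact hi'.2 (Set.mem_biUnion (Finset.mem_coe.2 hwi.1) ⟨hN hi'.1, hwi.2⟩)⟩)
      refine ⟨L, hL, hLinf, ∅, fun i hi i' hi' hne => ?_⟩
      rcases lt_or_gt_of_ne hne with h | h
      · rw [hdis i hi i' ⟨hi', h⟩]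
      · rw [Finset.inter_comm, hdis i' hi' i ⟨hi, h⟩]

/-! ### Growth of the parameters -/

theorem eight_le_log_m (j : ℕ) : 8 ≤ Nat.log 2 (m (j + 2) ^ 4) := by
  refine (Nat.le_log_iff_pow_le one_lt_two (by have := one_le_m (j + 2); positivity)).2 ?_
  calc 2 ^ 8 = (2 ^ 2) ^ 4 := by norm_num
    _ ≤ m (j + 2) ^ 4 := Nat.pow_le_pow_left
      ((Nat.pow_le_pow_right two_pos (by omega)).trans (two_pow_le_m (j + 2))) 4

theorem one_le_n (j : ℕ) : 1 ≤ n j := by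
  induction j using n.induct with
  | case1 => simp [n]
  | case2 => simp [n]
  | case3 j ih => rw [n]; exact Nat.one_le_pow _ _ (by omega)

theorem n_lt_n_succ (j : ℕ) : n j < n (j + 1) := by
  cases j with
  | zero => simp [n]
  | succ j =>
    have h1 := one_le_n (j + 1)
    have h2 := eight_le_log_m j
    rw [n]
    calc n (j + 1) < 2 * n (j + 1) := by omega
      _ ≤ _ := Nat.le_self_pow (by omega) _

theorem n_strictMono : StrictMono n := strictMono_nat_of_lt_succ n_lt_n_succ

theorem m_pow_le_n (j : ℕ) : m (j + 2) ^ 26 ≤ n (j + 2) := by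
  have h7 : 2 ^ 7 ≤ n (j + 1) := n_strictMono.monotone (show 1 ≤ j + 1 by omega)
  have h8 := eight_le_log_m j
  have hm := one_le_m (j + 2)
  set p := Nat.log 2 (m (j + 2) ^ 4) with hp
  have hlt : m (j + 2) ^ 4 < 2 ^ (p + 1) := Nat.lt_pow_succ_log_self one_lt_two _
  rw [n, ← hp]
  calc m (j + 2) ^ 26 ≤ m (j + 2) ^ (4 * 7) := Nat.pow_le_pow_right hm (by norm_num)
    _ = (m (j + 2) ^ 4) ^ 7 := pow_mul _ _ _
    _ ≤ (2 ^ (p + 1)) ^ 7 := Nat.pow_le_pow_left hlt.le 7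
    _ = 2 ^ ((p + 1) * 7) := (pow_mul _ _ _).symm
    _ ≤ 2 ^ (8 * p) := Nat.pow_le_pow_right two_pos (by omega)
    _ = (2 ^ 8) ^ p := pow_mul _ _ _
    _ ≤ (2 * n (j + 1)) ^ p := Nat.pow_le_pow_left (by omega) p

theorem m_succ_succ_eq {t : ℕ} (ht : 1 ≤ t) : m (t + 2) = m t ^ 25 := by
  obtain ⟨t, rfl⟩ : ∃ r, t = r + 1 := ⟨t - 1, by omega⟩
  rw [show t + 1 + 2 = (t + 1) + 2 from rfl, m, m, ← pow_mul]

/-- Averages of length `k` can be normed by a weight `m_{2j}` that is small compared with `k`. -/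
theorem exists_threshold {ε : ℝ} (hε : 0 < ε) (C : ℝ) :
    ∃ n₀ : ℕ, ∀ k, n₀ < k → ∃ j, 1 ≤ j ∧ k ≤ n (2 * j) ∧ C ≤ (m (2 * j) : ℝ)⁻¹ * (k * ε) := by
  obtain ⟨T, hT⟩ := exists_nat_ge (C / ε)
  refine ⟨n (2 * (T + 1)), fun k hk => ?_⟩
  have hex : ∃ j, k ≤ n (2 * j) :=
    ⟨k, (by omega : k ≤ 2 * k).trans n_strictMono.le_apply⟩
  classical
  obtain ⟨j, hj, hmin⟩ : ∃ j, k ≤ n (2 * j) ∧ ∀ t < j, n (2 * t) < k :=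
    ⟨Nat.find hex, Nat.find_spec hex, fun t ht => not_le.1 (Nat.find_min hex ht)⟩
  -- Beyond T, the base `m (2 * j - 2)` dominates C / ε.
  have hTj : T + 1 < j := by
    by_contra h
    exact absurd (hj.trans (n_strictMono.monotone (by omega : 2 * j ≤ 2 * (T + 1))))
      (not_le.2 hk)
  obtain ⟨t, rfl⟩ : ∃ t, j = t + 2 := ⟨j - 2, by omega⟩
  refine ⟨t + 2, by omega, hj, ?_⟩
  -- Minimality of j gives k > `n (2 * j - 2)` ≥ `m (2 * j - 2)`²⁶, while `m (2 * j)` is only the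
  -- 25th power; the spare factor absorbs C / ε.
  have h1 := (m_pow_le_n (2 * t)).trans (hmin (t + 1) (by omega)).le
  have h2 : m (2 * (t + 2)) = m (2 * t + 2) ^ 25 := m_succ_succ_eq (t := 2 * t + 2) (by omega)
  have h3 : T ≤ m (2 * t + 2) := by
    have := two_pow_le_m (2 * t + 2)
    have := Nat.lt_two_pow_self (n := 2 * t + 2)
    omega
  have hpos : (0 : ℝ) < m (2 * t + 2) := by exact_mod_cast one_le_m _
  have h1' : (m (2 * t + 2) : ℝ) ^ 26 ≤ k := by exact_mod_cast h1
  have h3' : (T : ℝ) ≤ m (2 * t + 2) := by exact_mod_cast h3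
  rw [h2, Nat.cast_pow, le_inv_mul_iff₀ (by positivity)]
  have hC : C ≤ m (2 * t + 2) * ε := by
    rw [div_le_iff₀ hε] at hT
    exact hT.trans (by gcongr)
  calc (m (2 * t + 2) : ℝ) ^ 25 * C ≤ (m (2 * t + 2) : ℝ) ^ 25 * (m (2 * t + 2) * ε) := by gcongr
    _ = (m (2 * t + 2) : ℝ) ^ 26 * ε := by ring
    _ ≤ k * ε := by gcongr

/-! ### Lower estimate for sums of blocks -/

theorem IsBlock.before {x : ℕ → C00} (hx : IsBlock x) {i j : ℕ} (hij : i < j) :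
    Before (x i) (x j) := by
  induction j, hij using Nat.le_induction with
  | base => exact hx.2 i
  | succ j hij ih =>
    intro a ha b hb
    obtain ⟨c, hc⟩ := Finsupp.support_nonempty_iff.2 (hx.1 j)
    exact (ih a ha c hc).trans (hx.2 j c hc b hb)

theorem IsBlock.disjoint {x : ℕ → C00} (hx : IsBlock x) {i j : ℕ} (hij : i ≠ j) {l : ℕ+}
    (hi : x i l ≠ 0) : x j l = 0 := by
  by_contra hj
  rw [← Finsupp.mem_support_iff] at hi
  rw [← ne_eq, ← Finsupp.mem_support_iff] at hj
  rcases lt_or_gt_of_ne hij with h | h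
  · exact lt_irrefl l (hx.before h l hi l hj)
  · exact lt_irrefl l (hx.before h l hj l hi)

/-- Norming functionals cut to the supports of the x_i are successive and do not interact, so the
even operation applies to them. -/
theorem IsBlock.le_normOf_sum {x : ℕ → C00} (hx : IsBlock x) {ε : ℝ}
    (hε : ∀ i, ε < normOf G0 (x i)) {j : ℕ} (hj : 1 ≤ j) {F : Finset ℕ}
    (hF : F.card ≤ n (2 * j)) :
    (m (2 * j) : ℝ)⁻¹ * (F.card * ε) ≤ normOf G0 (∑ i ∈ F, x i) := by
  choose g hg hgε using fun i => exists_mem_G0_lt_act (hε i)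
  let h : ℕ → C00 := fun i => cut {l | x i l ≠ 0} (g i)
  have hsum : ((F.sort (· ≤ ·)).map h).sum = ∑ i ∈ F, h i := by
    rw [← List.sum_toFinset h (Finset.sort_nodup F (· ≤ ·)), Finset.sort_toFinset]
  have hmem : (m (2 * j) : ℝ)⁻¹ • ∑ i ∈ F, h i ∈ G0 := by
    refine isG0Closed_G0.even_op (2 * j) _
      ⟨⟨j, hj, rfl⟩, (F.sort (· ≤ ·)).map h, by simpa using hF, ?_, ?_, by rw [hsum]⟩
    · intro f hf
      obtain ⟨i, -, rfl⟩ := List.mem_map.1 hf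
      exact cut_mem_G0 _ (hg i)
    · refine (Finset.sortedLT_sort F).pairwise.map _ fun i i' hii' a ha b hb => ?_
      exact hx.before hii'
        a (Finsupp.mem_support_iff.2 (mem_of_cut_ne_zero (Finsupp.mem_support_iff.1 ha)).1)
        b (Finsupp.mem_support_iff.2 (mem_of_cut_ne_zero (Finsupp.mem_support_iff.1 hb)).1)
  refine le_trans ?_ ((le_abs_self _).trans (abs_act_le_normOf_G0 hmem _))
  rw [act_smul_left, act_sum_left]
  refine mul_le_mul_of_nonneg_left ?_ (by positivity)
  rw [← nsmul_eq_mul, ← Finset.sum_const]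
  refine Finset.sum_le_sum fun i hi => ?_
  have h1 : act (h i) (∑ i ∈ F, x i) = act (h i) (x i) := by
    rw [act_sum_right]
    exact Finset.sum_eq_single_of_mem i hi fun i' _ hne =>
      act_cut_eq_zero fun l hl _ => hx.disjoint hne.symm hl
  have h2 : act (h i) (x i) = act (g i) (x i) := act_cut_eq fun l hl => hl
  rw [h1, h2]
  exact (hgε i).le

/-! ### Weights that are large on a vector -/

/-- The indices of the weights of functionals in `G₀` that exceed `δ` at `x`. -/
def largeWeights (δ : ℝ) (x : C00) : Set ℕ := {w | ∃ f, HasWeight G0 w f ∧ δ < act f x}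

theorem mem_largeWeights {δ : ℝ} {x f : C00} {w : ℕ} (hf : HasWeight G0 w f)
    (h : δ < |act f x|) : w ∈ largeWeights δ x := by
  rcases lt_abs.1 h with h | h
  · exact ⟨f, hf, h⟩
  · exact ⟨-f, hf.neg isG0Closed_G0.symm, by rwa [act_neg_left]⟩

/-- Taking one functional per weight, q² of them with coefficients 1/q form an admissible
ℓ₂-combination whose value exceeds qδ ≥ 1. -/
theorem card_ne_of_subset_largeWeights {δ : ℝ} {x : C00} (hx : normOf G0 x ≤ 1) {q : ℕ}
    (hq : 0 < q) (hδ : 1 ≤ q * δ) {T : Finset ℕ} (hT : (T : Set ℕ) ⊆ largeWeights δ x) :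
    T.card ≠ q ^ 2 := by
  intro hcard
  have hq' : (0 : ℝ) < q := by exact_mod_cast hq
  choose f hf hfδ using fun w : T => hT w.2
  have hmem := isG0Closed_G0.l2_op T.card (fun _ => (q : ℚ)⁻¹) (fun r => f (T.equivFin.symm r))
    (fun r => (T.equivFin.symm r : ℕ))
    (by
      have : (q : ℚ) ≠ 0 := by exact_mod_cast hq.ne'
      rw [Finset.sum_const, Finset.card_univ, Fintype.card_fin, nsmul_eq_mul, hcard]
      push_cast
      rw [← mul_pow, mul_inv_cancel₀ this, one_pow])
    (fun r => isG0Closed_G0.even_op _ _ (hf _)) (fun r => hf _)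
    (Subtype.val_injective.comp T.equivFin.symm.injective)
  have hle := ((le_abs_self _).trans (abs_act_le_normOf_G0 hmem x)).trans hx
  rw [act_sum_left] at hle
  have hlt : ∑ _r : Fin T.card, (q : ℝ)⁻¹ * δ <
      ∑ r : Fin T.card, act ((((q : ℚ)⁻¹ : ℚ) : ℝ) • f (T.equivFin.symm r)) x := by
    refine Finset.sum_lt_sum_of_nonempty ?_ fun r _ => ?_
    · rw [Finset.univ_nonempty_iff, ← Fin.pos_iff_nonempty, hcard]
      positivity
    · rw [act_smul_left]
      push_cast
      exact mul_lt_mul_of_pos_left (hfδ _) (by positivity)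
  have hsum : ∑ _r : Fin T.card, (q : ℝ)⁻¹ * δ = q * δ := by
    rw [Finset.sum_const, Finset.card_univ, Fintype.card_fin, nsmul_eq_mul, hcard]
    push_cast
    field_simp
  linarith

theorem largeWeights_finite {δ : ℝ} {x : C00} (hx : normOf G0 x ≤ 1) {q : ℕ}
    (hq : 0 < q) (hδ : 1 ≤ q * δ) : (largeWeights δ x).Finite := by
  by_contra h
  obtain ⟨T, hT, hcard⟩ := Set.Infinite.exists_subset_card_eq h (q ^ 2)
  exact card_ne_of_subset_largeWeights hx hq hδ hT hcard

theorem card_largeWeights_le {δ : ℝ} {x : C00} (hx : normOf G0 x ≤ 1) {q : ℕ}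
    (hq : 0 < q) (hδ : 1 ≤ q * δ) : (largeWeights_finite hx hq hδ).toFinset.card ≤ q ^ 2 := by
  by_contra! h
  obtain ⟨T, hT, hcard⟩ := Finset.exists_subset_card_eq h.le
  refine card_ne_of_subset_largeWeights hx hq hδ (fun w hw => ?_) hcard
  exact (Set.Finite.mem_toFinset _).1 (hT hw)

theorem IsBlock.eventually_before {x : ℕ → C00} (hx : IsBlock x) (f : C00) :
    ∀ᶠ i in Filter.atTop, Before f (x i) := by
  have hlt : ∀ i, ∀ l ∈ (x i).support, i < (l : ℕ) := by
    intro i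
    induction i with
    | zero => exact fun l _ => l.pos
    | succ i ih =>
      intro l hl
      obtain ⟨c, hc⟩ := Finsupp.support_nonempty_iff.2 (hx.1 i)
      have h1 := ih c hc
      have h2 : (c : ℕ) < l := hx.2 i c hc l hl
      omega
  filter_upwards [Filter.eventually_ge_atTop (f.support.sup fun a => (a : ℕ))] with i hi a ha b hb
  have h1 : (a : ℕ) ≤ f.support.sup fun a => (a : ℕ) :=
    Finset.le_sup (f := fun a : ℕ+ => (a : ℕ)) ha
  have h2 := hlt i b hb
  exact PNat.coe_lt_coe _ _ |>.1 (by omega)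

/-! ### Separation of the histories of weights -/

/-- Outside a finite set `R` of weights whose histories precede all `x i`, `i ∈ L`, no two weights
in one history are large on different vectors `x i`, `i ∈ L`. -/
def Separated (σ : List C00 → ℕ) (x : ℕ → C00) (N : ℕ) (δ : ℝ) (L : Set ℕ) : Prop :=
  ∃ R : Finset ℕ, (∀ s ∈ Qs, σ s ∈ R → ∀ i ∈ L, ∀ f ∈ s, Before f (x i)) ∧
    ∀ i ∈ L, ∀ i' ∈ L, i ≠ i' → ∀ s ∈ Qs, s.length ≤ N → ∀ r, s.take r ∈ Qs →
      σ (s.take r) ∈ largeWeights δ (x i) → σ s ∈ largeWeights δ (x i') → σ (s.take r) ∈ R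

theorem Separated.mono {σ : List C00 → ℕ} {x : ℕ → C00} {N : ℕ} {δ : ℝ} {L L' : Set ℕ}
    (hL : L ⊆ L') (h : Separated σ x N δ L') : Separated σ x N δ L := by
  obtain ⟨R, h1, h2⟩ := h
  exact ⟨R, fun s hs hR i hi => h1 s hs hR i (hL hi),
    fun i hi i' hi' => h2 i (hL hi) i' (hL hi')⟩

/-- Attach to x_i the codes of all prefixes of histories, of length at most N, of its large weights:
boundedly many, so the Δ-system lemma applies. The histories coded by R involve finitely many
functionals, which precede all x_i from some i on. -/
theorem exists_separated {Ω₁ Ω₂ : Set ℕ} {σ : List C00 → ℕ} (hσ : IsCoding Ω₁ Ω₂ σ)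
    {x : ℕ → C00} (hx : IsBlock x) (hx1 : ∀ i, normOf G0 (x i) ≤ 1) (N : ℕ) {q : ℕ} {δ : ℝ}
    (hq : 0 < q) (hδ : 1 ≤ q * δ) {M : Set ℕ} (hM : M.Infinite) :
    ∃ L ⊆ M, L.Infinite ∧ Separated σ x N δ L := by
  classical
  let past : ℕ → List C00 := Function.invFunOn σ Qs
  have hpast : ∀ s ∈ Qs, past (σ s) = s := fun s hs => hσ.injOn.leftInvOn_invFunOn hs
  let W : ℕ → Finset ℕ := fun i => (largeWeights_finite (hx1 i) hq hδ).toFinset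
  let P : ℕ → Finset ℕ := fun i =>
    (W i ×ˢ Finset.range (N + 1)).image fun p => σ ((past p.1).take p.2)
  have hP : ∀ i ∈ M, (P i).card ≤ q ^ 2 * (N + 1) := fun i _ => by
    refine Finset.card_image_le.trans ?_
    rw [Finset.card_product, Finset.card_range]
    exact Nat.mul_le_mul_right _ (card_largeWeights_le (hx1 i) hq hδ)
  have hPmem : ∀ i, ∀ s ∈ Qs, s.length ≤ N → σ s ∈ largeWeights δ (x i) → ∀ r,
      σ (s.take r) ∈ P i := by
    intro i s hs hN hw r
    -- Truncating r at the length keeps it in the finite range without changing the prefix.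
    refine Finset.mem_image.2 ⟨(σ s, min r s.length), ?_, ?_⟩
    · rw [Finset.mem_product, Finset.mem_range]
      exact ⟨(Set.Finite.mem_toFinset _).2 hw, by simp only; omega⟩
    · simp only
      rw [hpast s hs, ← List.take_eq_take_min]
  obtain ⟨L, hL, hLinf, R, hR⟩ := exists_infinite_deltaSystem _ P hM hP
  have hev : ∀ᶠ i in Filter.atTop, ∀ w ∈ R, ∀ f ∈ past w, Before f (x i) :=
    (Filter.eventually_all_finset R).2 fun w _ =>
      (Filter.eventually_all_finite (List.finite_toSet (past w))).2 fun f _ =>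
        hx.eventually_before f
  obtain ⟨B, hB⟩ := Filter.eventually_atTop.1 hev
  refine ⟨L \ Set.Iio B, Set.sdiff_subset.trans hL, hLinf.sdiff (Set.finite_Iio B), R, ?_, ?_⟩
  · intro s hs hsR i hi f hf
    refine hB i (not_lt.1 hi.2) (σ s) hsR f ?_
    rwa [hpast s hs]
  · intro i hi i' hi' hne s hs hN r hr hwr hw
    refine hR i hi.1 i' hi'.1 hne (Finset.mem_inter.2 ⟨?_, hPmem i' s hs hN hw r⟩)
    -- The prefix is attached to i as a prefix of itself and to i' as a prefix of s.
    have := hPmem i (s.take r) hr ((List.length_take_le' _ _).trans hN) hwr r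
    rwa [List.take_take, min_self] at this

/-- Cutting a functional to the supports of the smaller family stays in G₀ and kills the other
blocks. -/
theorem IsBlock.normOf_sum_mono {x : ℕ → C00} (hx : IsBlock x) {F' F : Finset ℕ} (h : F' ⊆ F) :
    normOf G0 (∑ i ∈ F', x i) ≤ normOf G0 (∑ i ∈ F, x i) := by
  refine csSup_le (Set.Nonempty.image _ ⟨0, zero_mem_G0⟩) ?_
  rintro _ ⟨f, hf, rfl⟩
  refine le_trans (le_of_eq ?_) (abs_act_le_normOf_G0
    (cut_mem_G0 {l | ∃ i ∈ F', x i l ≠ 0} hf) _)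
  simp only [act_sum_right]
  congr 1
  refine (Finset.sum_congr rfl fun i hi => ?_).trans (Finset.sum_subset h fun i _ hi => ?_)
  · exact (act_cut_eq (A := {l | ∃ i ∈ F', x i l ≠ 0}) fun l hl => ⟨i, hi, hl⟩).symm
  · refine act_cut_eq_zero fun l hl _ => ?_
    obtain ⟨i', hi', hl⟩ := hl
    exact hx.disjoint (ne_of_mem_of_not_mem hi' hi) hl

/-! ### Estimates for special functionals -/

theorem sum_eq_sum_range_getD (s : List C00) : s.sum = ∑ l ∈ Finset.range s.length, s.getD l 0 := by
  rw [Finset.sum_range, ← Fin.sum_univ_getElem]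
  exact Finset.sum_congr rfl fun l _ => by simp

theorem take_mem_Qs {s : List C00} (hs : s ∈ Qs) {l : ℕ} (hl : 1 ≤ l) : s.take l ∈ Qs := by
  refine ⟨?_, fun f hf => hs.2.1 f (List.mem_of_mem_take hf), hs.2.2.sublist (List.take_sublist _ _)⟩
  rw [ne_eq, List.take_eq_nil_iff]
  rintro (h | h)
  · omega
  · exact hs.1 h

theorem getD_mem {s : List C00} {l : ℕ} (hl : l < s.length) : s.getD l 0 ∈ s := by
  rw [List.getD_eq_getElem _ _ hl]
  exact List.getElem_mem hl

theorem IsSpecial.hasWeight_getD {Ω₁ : Set ℕ} {σ : List C00 → ℕ} {j : ℕ} {s : List C00}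
    (hs : IsSpecial Ω₁ σ j s) {l : ℕ} (hl : 1 ≤ l) (hl' : l < s.length) :
    HasWeight G0 (σ (s.take l)) (s.getD l 0) := by
  rw [List.getD_eq_getElem _ _ hl']
  exact hs.2.2.2 l hl hl'

/-- The coordinates of all terms of a special sequence are small. -/
theorem IsSpecial.abs_getD_le {Ω₁ Ω₂ : Set ℕ} {σ : List C00 → ℕ} (hσ : IsCoding Ω₁ Ω₂ σ) {j : ℕ}
    {s : List C00} (hs : IsSpecial Ω₁ σ j s) {l : ℕ} (hl : l < s.length) (e : ℕ+) :
    |s.getD l 0 e| ≤ ((n (2 * j + 1) : ℝ) ^ 2)⁻¹ := by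
  have hN : (0 : ℝ) < n (2 * j + 1) := by exact_mod_cast one_le_n _
  obtain ⟨j₁, -, hj₁, f, hf, hfw⟩ := hs.2.2.1
  have hj₁' : (n (2 * j + 1) : ℝ) ^ 2 ≤ m (2 * j₁) := by exact_mod_cast hj₁.le
  have h0 : ∀ e, |f e| ≤ (m (2 * j₁) : ℝ)⁻¹ := hfw.abs_le_inv_m
  obtain ⟨t, rfl⟩ : ∃ t, s = f :: t := by
    cases s with
    | nil => simp at hf
    | cons g t => exact ⟨t, by simp at hf; rw [hf]⟩
  rcases Nat.eq_zero_or_pos l with rfl | hlpos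
  · exact (h0 e).trans (by gcongr)
  · refine ((hs.hasWeight_getD hlpos hl).abs_le_inv_m e).trans ?_
    have hQ := take_mem_Qs hs.1 hlpos
    have hfm : f ∈ (f :: t).take l := by
      obtain ⟨l, rfl⟩ : ∃ r, l = r + 1 := ⟨l - 1, by omega⟩
      simp
    obtain ⟨a, ha⟩ := Finsupp.support_nonempty_iff.2 (hs.1.2.1 f (by simp)).2
    obtain ⟨b, hb⟩ := Finsupp.support_nonempty_iff.2
      (hQ.2.1 _ (List.getLast_mem hQ.1)).2
    have hg := hσ.growth _ hQ f hfm a ha _ (List.getLast_mem_getLast? hQ.1) b hb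
    have hfa : 0 < |f a| := abs_pos.2 (Finsupp.mem_support_iff.1 ha)
    have hb1 : (1 : ℝ) ≤ ((b : ℕ) : ℝ) := by exact_mod_cast b.pos
    have hm1 : (m (2 * j₁) : ℝ) ≤ 1 / |f a| := by
      rw [one_div]
      have hpos : (0 : ℝ) < m (2 * j₁) := by exact_mod_cast one_le_m _
      exact (le_inv_comm₀ hpos hfa).2 (h0 a)
    -- A nonzero coordinate of the first term has absolute value at most 1 / `m (2 * j₁)`, so the
    -- growth condition on σ forces every later weight above `m (2 * j₁)`.
    have : (n (2 * j + 1) : ℝ) ^ 2 ≤ m (σ ((f :: t).take l)) :=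
      hj₁'.trans (hm1.trans ((le_mul_of_one_le_right (by positivity) hb1).trans hg.le))
    gcongr

theorem act_cut_sum (A : Set ℕ+) (s : List C00) (x : C00) :
    act (cut A s.sum) x = ∑ l ∈ Finset.range s.length, act (cut A (s.getD l 0)) x := by
  rw [sum_eq_sum_range_getD, map_sum, act_sum_left]

/-- A special functional of large weight is negligible on a fixed vector. -/
theorem IsSpecial.abs_act_le_of_l1norm_le {Ω₁ Ω₂ : Set ℕ} {σ : List C00 → ℕ}
    (hσ : IsCoding Ω₁ Ω₂ σ) {j : ℕ} {s : List C00} (hs : IsSpecial Ω₁ σ j s) (A : Set ℕ+) {x : C00}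
    {k : ℕ} (hk : 0 < k) (hx : k * l1norm x ≤ n (2 * j + 1)) :
    |act (cut A s.sum) x| ≤ (k : ℝ)⁻¹ := by
  have hN : (0 : ℝ) < n (2 * j + 1) := by exact_mod_cast one_le_n _
  have hk' : (0 : ℝ) < k := by exact_mod_cast hk
  rw [act_cut_sum, hs.2.1]
  refine (Finset.abs_sum_le_sum_abs _ _).trans ?_
  calc ∑ l ∈ Finset.range (n (2 * j + 1)), |act (cut A (s.getD l 0)) x|
      ≤ ∑ l ∈ Finset.range (n (2 * j + 1)), ((n (2 * j + 1) : ℝ) ^ 2)⁻¹ * l1norm x := by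
        refine Finset.sum_le_sum fun l hl => abs_act_le_l1norm (fun e => ?_) x
        exact (abs_cut_apply_le A _ e).trans
          (hs.abs_getD_le hσ (by rw [hs.2.1]; exact Finset.mem_range.1 hl) e)
    _ = l1norm x / n (2 * j + 1) := by
        rw [Finset.sum_const, Finset.card_range, nsmul_eq_mul]
        field_simp
    _ ≤ (k : ℝ)⁻¹ := by
        rw [div_le_iff₀ hN, le_inv_mul_iff₀ hk']
        exact hx

/-- On a separated subsequence all but two terms of a special sequence, those with indices in `G`,
are small on all but one of the vectors. -/
theorem IsSpecial.exists_exceptional {Ω₁ : Set ℕ} {σ : List C00 → ℕ} {j : ℕ}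
    {s : List C00} (hs : IsSpecial Ω₁ σ j s) (A : Set ℕ+) {x : ℕ → C00} {δ : ℝ} (hδ : 0 < δ)
    {L : Set ℕ} (hL : Separated σ x (n (2 * j + 1)) δ L) :
    ∃ G ⊆ Finset.range s.length, G.card ≤ 2 ∧ ∃ e, ∀ i ∈ L, i ≠ e →
      ∀ l ∈ Finset.range s.length \ G, |act (cut A (s.getD l 0)) (x i)| ≤ δ := by
  classical
  obtain ⟨R, hR, hsep⟩ := hL
  -- Positions whose weight is coded in R. Terms before the last such position belong to its
  -- history, hence vanish on every x_i with i in L; later terms have weights outside R.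
  set T := {l ∈ Finset.range s.length | 1 ≤ l ∧ σ (s.take l) ∈ R} with hT
  have hlen : 0 < s.length := List.length_pos_iff.2 hs.1.1
  have hsup : T.sup id = 0 ∨ T.sup id ∈ T := by
    rcases T.eq_empty_or_nonempty with h | h
    · left; rw [h]; rfl
    · right
      obtain ⟨l, hl, hle⟩ := Finset.exists_mem_eq_sup T h id
      rw [hle]; exact hl
  have key : ∀ i ∈ L, ∀ l < s.length, l ≠ 0 → l ≠ T.sup id →
      δ < |act (cut A (s.getD l 0)) (x i)| →
        σ (s.take l) ∈ largeWeights δ (x i) ∧ σ (s.take l) ∉ R := by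
    intro i hi l hl h0 hsupl hlt
    have hl1 : 1 ≤ l := Nat.one_le_iff_ne_zero.2 h0
    refine ⟨mem_largeWeights ((hs.hasWeight_getD hl1 hl).cut A fun f hf => cut_mem_G0 A hf) hlt, ?_⟩
    intro hlR
    have hle : l ≤ T.sup id :=
      Finset.le_sup (f := id) (Finset.mem_filter.2 ⟨Finset.mem_range.2 hl, hl1, hlR⟩)
    have hlt' : l < T.sup id := lt_of_le_of_ne hle hsupl
    have hmem : T.sup id ∈ T := hsup.resolve_left (by omega)
    rw [hT, Finset.mem_filter, ← hT] at hmem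
    have hlm : s.getD l 0 ∈ s.take (T.sup id) := by
      rw [List.getD_eq_getElem _ _ hl]
      exact List.mem_take_iff_getElem.2 ⟨l, by omega, rfl⟩
    have := (hR _ (take_mem_Qs hs.1 hmem.2.1) hmem.2.2 i hi _ hlm).act_cut_eq_zero A
    rw [this, abs_zero] at hlt
    exact lt_asymm hδ hlt
  have huniq : ∀ i ∈ L, ∀ i' ∈ L, ∀ l < s.length, ∀ l' < s.length, l ≠ 0 → l' ≠ 0 →
      l ≠ T.sup id → l' ≠ T.sup id → δ < |act (cut A (s.getD l 0)) (x i)| →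
      δ < |act (cut A (s.getD l' 0)) (x i')| → l ≤ l' → i = i' := by
    intro i hi i' hi' l hl l' hl' h0 h0' hT hT' hb hb' hle
    by_contra hne
    have h1 := key i hi l hl h0 hT hb
    have h2 := key i' hi' l' hl' h0' hT' hb'
    have htake : (s.take l').take l = s.take l := by rw [List.take_take, min_eq_left hle]
    have := hsep i hi i' hi' hne (s.take l') (take_mem_Qs hs.1 (Nat.one_le_iff_ne_zero.2 h0'))
      ((List.length_take_le' _ _).trans hs.2.1.le) l
      (by rw [htake]; exact take_mem_Qs hs.1 (Nat.one_le_iff_ne_zero.2 h0))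
      (by rw [htake]; exact h1.1) h2.1
    rw [htake] at this
    exact h1.2 this
  -- The first term is exceptional because its weight is not a value of σ on a prefix of s. If T is
  -- empty, its supremum is 0 and nothing is added.
  refine ⟨{0, T.sup id}, ?_, Finset.card_le_two, ?_⟩
  · intro l hl
    rw [Finset.mem_insert, Finset.mem_singleton] at hl
    rw [Finset.mem_range]
    rcases hl with rfl | rfl
    · exact hlen
    · rcases hsup with h | h
      · omega
      · exact Finset.mem_range.1 (Finset.mem_filter.1 h).1
  · by_cases hex : ∃ e ∈ L, ∃ l < s.length, l ≠ 0 ∧ l ≠ T.sup id ∧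
        δ < |act (cut A (s.getD l 0)) (x e)|
    · obtain ⟨e, he, l, hl, hl0, hlT, hbig⟩ := hex
      refine ⟨e, fun i hi hne l' hl' => ?_⟩
      simp only [Finset.mem_sdiff, Finset.mem_range, Finset.mem_insert, Finset.mem_singleton,
        not_or] at hl'
      by_contra! hbig'
      rcases le_total l l' with h | h
      · exact hne (huniq e he i hi l hl l' hl'.1 hl0 hl'.2.1 hlT hl'.2.2 hbig hbig' h).symm
      · exact hne (huniq i hi e he l' hl'.1 l hl hl'.2.1 hl0 hl'.2.2 hlT hbig' hbig h)
    · refine ⟨0, fun i hi _ l hl => ?_⟩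
      simp only [Finset.mem_sdiff, Finset.mem_range, Finset.mem_insert, Finset.mem_singleton,
        not_or] at hl
      by_contra! hbig
      exact hex ⟨i, hi, l, hl.1, hl.2.1, hl.2.2, hbig⟩

theorem IsSpecial.abs_act_sum_le {Ω₁ : Set ℕ} {σ : List C00 → ℕ} {j : ℕ}
    {s : List C00} (hs : IsSpecial Ω₁ σ j s) (A : Set ℕ+) {x : ℕ → C00}
    (hx1 : ∀ i, normOf G0 (x i) ≤ 1) {c : ℝ} (hA : ∀ i, |act (cut A s.sum) (x i)| ≤ c) {k : ℕ}
    {δ : ℝ} (hδ : 0 < δ) (hkδ : k * (n (2 * j + 1) * δ) ≤ 1)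
    {L : Set ℕ} (hL : Separated σ x (n (2 * j + 1)) δ L) {F : Finset ℕ} (hF : (F : Set ℕ) ⊆ L)
    (hFk : F.card ≤ k) :
    |act (cut A s.sum) (∑ i ∈ F, x i)| ≤ 2 * normOf G0 (∑ i ∈ F, x i) + (c + 3) := by
  classical
  obtain ⟨G, hGs, hG2, e, he⟩ := hs.exists_exceptional A hδ hL
  have hmem : ∀ l ∈ G, cut A (s.getD l 0) ∈ G0 := fun l hl =>
    cut_mem_G0 A (hs.1.2.1 _ (getD_mem (Finset.mem_range.1 (hGs hl)))).1
  have hGle : ∀ y : C00, |∑ l ∈ G, act (cut A (s.getD l 0)) y| ≤ 2 * normOf G0 y := fun y => by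
    have h0 : 0 ≤ normOf G0 y := (abs_nonneg _).trans (abs_act_le_normOf_G0 zero_mem_G0 y)
    calc |∑ l ∈ G, act (cut A (s.getD l 0)) y| ≤ ∑ l ∈ G, normOf G0 y :=
          (Finset.abs_sum_le_sum_abs _ _).trans
            (Finset.sum_le_sum fun l hl => abs_act_le_normOf_G0 (hmem l hl) y)
      _ = G.card * normOf G0 y := by rw [Finset.sum_const, nsmul_eq_mul]
      _ ≤ 2 * normOf G0 y := mul_le_mul_of_nonneg_right (by exact_mod_cast hG2) h0
  let D : C00 → ℝ := fun y => ∑ l ∈ Finset.range s.length \ G, act (cut A (s.getD l 0)) y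
  have hsplit : ∀ y, act (cut A s.sum) y = D y + ∑ l ∈ G, act (cut A (s.getD l 0)) y := fun y => by
    rw [act_cut_sum, Finset.sum_sdiff hGs]
  have hDsum : D (∑ i ∈ F, x i) = ∑ i ∈ F, D (x i) := by
    simp only [D, act_sum_right]
    exact Finset.sum_comm
  -- The whole functional is at most c on x_e, and the two removed terms account for at most 2.
  have hDe : |D (x e)| ≤ c + 2 := by
    have h1 := hA e
    have h2 := hGle (x e)
    have h3 := hx1 e
    rw [hsplit] at h1
    rw [abs_le] at h1 h2 ⊢
    constructor <;> linarith
  have hDi : ∀ i ∈ F, i ≠ e → |D (x i)| ≤ n (2 * j + 1) * δ := fun i hi hne => by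
    calc |D (x i)| ≤ ∑ l ∈ Finset.range s.length \ G, δ :=
          (Finset.abs_sum_le_sum_abs _ _).trans (Finset.sum_le_sum (he i (hF hi) hne))
      _ ≤ ∑ l ∈ Finset.range s.length, δ :=
          Finset.sum_le_sum_of_subset_of_nonneg Finset.sdiff_subset fun _ _ _ => hδ.le
      _ = n (2 * j + 1) * δ := by rw [Finset.sum_const, Finset.card_range, nsmul_eq_mul, hs.2.1]
  have hc : 0 ≤ c + 2 := (abs_nonneg _).trans hDe
  have hDF : |D (∑ i ∈ F, x i)| ≤ c + 3 := by
    rw [hDsum]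
    calc |∑ i ∈ F, D (x i)| ≤ ∑ i ∈ F, ((if i = e then c + 2 else 0) + n (2 * j + 1) * δ) := by
          refine (Finset.abs_sum_le_sum_abs _ _).trans (Finset.sum_le_sum fun i hi => ?_)
          split_ifs with h
          · rw [h]
            exact hDe.trans (le_add_of_nonneg_right (by positivity))
          · rw [zero_add]
            exact hDi i hi h
      _ = (if e ∈ F then c + 2 else 0) + F.card * (n (2 * j + 1) * δ) := by
          rw [Finset.sum_add_distrib, Finset.sum_ite_eq', Finset.sum_const, nsmul_eq_mul]
      _ ≤ (c + 2) + k * (n (2 * j + 1) * δ) := by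
          gcongr
          split_ifs <;> linarith
      _ ≤ c + 3 := by linarith
  rw [hsplit]
  exact (abs_add_le _ _).trans (by linarith [hGle (∑ i ∈ F, x i)])

/-! ### Choice of the subsequence and conclusion -/

/-- The subsequence on which restricted special functionals are dominated by the `G₀`-norm. -/
theorem exists_subsequence_special_le {Ω₁ Ω₂ : Set ℕ} {σ : List C00 → ℕ} (hσ : IsCoding Ω₁ Ω₂ σ)
    {x : ℕ → C00} (hx : IsBlock x) (hx1 : ∀ i, normOf G0 (x i) ≤ 1) {k : ℕ} (hk : 0 < k) :
    ∃ L : Set ℕ, L.Infinite ∧ ∀ F : Finset ℕ, (F : Set ℕ) ⊆ L → F.card = k →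
      ∀ (j : ℕ) (s : List C00) (A : Set ℕ+), IsSpecial Ω₁ σ j s → ∀ c : ℝ,
        (∀ i, |act (cut A s.sum) (x i)| ≤ c) →
          |act (cut A s.sum) (∑ i ∈ F, x i)| ≤ 2 * normOf G0 (∑ i ∈ F, x i) + (2 * c + 4) := by
  classical
  -- With this δ, N terms on at most k vectors add up to at most 1.
  let δ : ℕ → ℝ := fun j => ((k * n (2 * j + 1) : ℕ) : ℝ)⁻¹
  have hkN : ∀ j, 0 < k * n (2 * j + 1) := fun j => Nat.mul_pos hk (one_le_n _)
  have hδ : ∀ j, 0 < δ j := fun j => inv_pos.2 (by exact_mod_cast hkN j)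
  have hδ1 : ∀ j, ((k * n (2 * j + 1) : ℕ) : ℝ) * δ j = 1 := fun j =>
    mul_inv_cancel₀ (by exact_mod_cast (hkN j).ne')
  -- From j = `J i` on, special functionals are at most 1/k on x_i.
  let J : ℕ → ℕ := fun i => ⌈k * l1norm (x i)⌉₊
  have hJ : ∀ i j, J i ≤ j → k * l1norm (x i) ≤ n (2 * j + 1) := fun i j hij => by
    have h : J i ≤ n (2 * j + 1) := hij.trans ((by omega : j ≤ 2 * j + 1).trans n_strictMono.le_apply)
    exact (Nat.le_ceil _).trans (by exact_mod_cast h)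
  have hex : ∀ t : ℕ, ∀ N : Set ℕ, N.Infinite → ∃ N' ⊆ N, N'.Infinite ∧
      ∀ j < t, Separated σ x (n (2 * j + 1)) (δ j) N' := by
    intro t N hN
    induction t with
    | zero => exact ⟨N, subset_rfl, hN, fun j hj => absurd hj (Nat.not_lt_zero j)⟩
    | succ t ih =>
      obtain ⟨N', hN', hinf, h⟩ := ih
      obtain ⟨N'', hN'', hinf', h'⟩ := exists_separated hσ hx hx1 (n (2 * t + 1)) (hkN t)
        (hδ1 t).ge hinf
      refine ⟨N'', hN''.trans hN', hinf', fun j hj => ?_⟩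
      rcases Nat.lt_succ_iff_lt_or_eq.1 hj with hj | rfl
      · exact (h j hj).mono hN''
      · exact h'
  obtain ⟨L, -, hLinf, hL⟩ := exists_infinite_diagonal Set.infinite_univ
    (fun i N => ∀ j < J i, Separated σ x (n (2 * j + 1)) (δ j) N)
    (fun i A B hAB h j hj => (h j hj).mono hAB) (fun i N _ hN => hex (J i) N hN)
  refine ⟨L, hLinf, fun F hF hFk j s A hs c hc => ?_⟩
  have hk' : (0 : ℝ) < k := by exact_mod_cast hk
  have hc0 : 0 ≤ c := (abs_nonneg _).trans (hc 0)
  have hneg : ∀ F' ⊆ F, (∀ i ∈ F', J i ≤ j) → |act (cut A s.sum) (∑ i ∈ F', x i)| ≤ 1 := by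
    intro F' hF' h
    rw [act_sum_right]
    calc |∑ i ∈ F', act (cut A s.sum) (x i)| ≤ ∑ i ∈ F', (k : ℝ)⁻¹ :=
          (Finset.abs_sum_le_sum_abs _ _).trans (Finset.sum_le_sum fun i hi =>
            hs.abs_act_le_of_l1norm_le hσ A hk (hJ i j (h i hi)))
      _ ≤ ∑ i ∈ F, (k : ℝ)⁻¹ :=
          Finset.sum_le_sum_of_subset_of_nonneg hF' fun _ _ _ => by positivity
      _ = 1 := by rw [Finset.sum_const, nsmul_eq_mul, hFk, mul_inv_cancel₀ hk'.ne']
  have hnorm0 : 0 ≤ normOf G0 (∑ i ∈ F, x i) :=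
    (abs_nonneg _).trans (abs_act_le_normOf_G0 zero_mem_G0 _)
  by_cases hbig : ∃ i, i ∈ F ∧ j < J i
  -- At the first i₀ that is not negligible for j, the sum splits with bounds 1 before it, c at it,
  -- and 2‖·‖ + c + 3 after it.
  · obtain ⟨i₀, ⟨hi₀, hji₀⟩, hmin⟩ : ∃ i, (i ∈ F ∧ j < J i) ∧ ∀ i' < i, ¬(i' ∈ F ∧ j < J i') :=
      ⟨Nat.find hbig, Nat.find_spec hbig, fun i' hi' => Nat.find_min hbig hi'⟩
    have hsub : {i ∈ F | i₀ < i} ⊆ F := Finset.filter_subset _ _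
    have hafter := hs.abs_act_sum_le A hx1 hc (k := k) (hδ j) (by
        have := hδ1 j
        push_cast at this
        rw [← mul_assoc, this]) (hL i₀ (hF hi₀) j hji₀) (F := {i ∈ F | i₀ < i})
      (fun i hi => by
        have := Finset.mem_filter.1 hi
        exact ⟨hF this.1, this.2⟩) ((Finset.card_le_card hsub).trans hFk.le)
    have hbefore := hneg {i ∈ F | i < i₀} (Finset.filter_subset _ _) fun i hi => by
      rw [Finset.mem_filter] at hi
      exact not_lt.1 fun h => hmin i hi.2 ⟨hi.1, h⟩
    have hsplit : ∑ i ∈ F, x i =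
        ∑ i ∈ F with i < i₀, x i + (x i₀ + ∑ i ∈ F with i₀ < i, x i) := by
      rw [← Finset.sum_filter_add_sum_filter_not F (fun i => i < i₀)]
      congr 1
      have : {i ∈ F | ¬i < i₀} = insert i₀ {i ∈ F | i₀ < i} := by
        ext i
        simp only [Finset.mem_filter, Finset.mem_insert, not_lt]
        constructor
        · rintro ⟨h1, h2⟩
          rcases h2.eq_or_lt with h | h
          · exact Or.inl h.symm
          · exact Or.inr ⟨h1, h⟩
        · rintro (rfl | ⟨h1, h2⟩)
          · exact ⟨hi₀, le_rfl⟩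
          · exact ⟨h1, h2.le⟩
      rw [this, Finset.sum_insert (by simp)]
    have hact : act (cut A s.sum) (∑ i ∈ F, x i) = act (cut A s.sum) (∑ i ∈ F with i < i₀, x i) +
        (act (cut A s.sum) (x i₀) + act (cut A s.sum) (∑ i ∈ F with i₀ < i, x i)) := by
      rw [hsplit]
      simp only [act_comm (cut A s.sum), act_eq_linearCombination, map_add]
    have hmono := hx.normOf_sum_mono hsub
    have h0 := hc i₀
    rw [hact]
    rw [abs_le] at hafter hbefore h0 ⊢
    constructor <;> linarith
  · push Not at hbig
    exact (hneg F subset_rfl hbig).trans (by linarith)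

end C0Saturated

theorem proposition4p1 (Ω₁ Ω₂ : Set ℕ) (σ : List C0Saturated.C00 → ℕ)
    (hσ : C0Saturated.IsCoding Ω₁ Ω₂ σ) :
    ∀ ε : ℝ, 0 < ε → ∃ n : ℕ, ∀ k : ℕ, n < k → ∀ x : ℕ → C0Saturated.C00,
      C0Saturated.IsBlock x →
      (∀ i, ε < C0Saturated.normOf C0Saturated.G0 (x i) ∧
        C0Saturated.normOf C0Saturated.G0 (x i) ≤
          C0Saturated.normOf (C0Saturated.W0 Ω₁ σ) (x i) ∧
        C0Saturated.normOf (C0Saturated.W0 Ω₁ σ) (x i) ≤ 1) →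
      ∃ L : Set ℕ, L.Infinite ∧
        ∀ F : Finset ℕ, (F : Set ℕ) ⊆ L → F.card = k →
          (∀ φ ∈ C0Saturated.W0 Ω₁ σ \ C0Saturated.G0,
            C0Saturated.act φ ((k : ℝ)⁻¹ • ∑ i ∈ F, x i) ≤
              C0Saturated.normOf C0Saturated.G0 ((k : ℝ)⁻¹ • ∑ i ∈ F, x i)) ∧
          C0Saturated.normOf (C0Saturated.W0 Ω₁ σ) ((k : ℝ)⁻¹ • ∑ i ∈ F, x i) =
            C0Saturated.normOf C0Saturated.G0 ((k : ℝ)⁻¹ • ∑ i ∈ F, x i) := by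
  open C0Saturated in
  intro ε hε
  obtain ⟨n₀, hn₀⟩ := exists_threshold hε 6
  refine ⟨n₀, fun k hk x hx hnorm => ?_⟩
  have hkpos : 0 < k := by omega
  obtain ⟨L, hLinf, hL⟩ := exists_subsequence_special_le hσ hx
    (fun i => (hnorm i).2.1.trans (hnorm i).2.2) hkpos
  refine ⟨L, hLinf, fun F hF hFk => ?_⟩
  obtain ⟨j₀, hj₀, hkj₀, h6⟩ := hn₀ k hk
  have hlow : 6 ≤ normOf G0 (∑ i ∈ F, x i) := by
    have := hx.le_normOf_sum (fun i => (hnorm i).1) hj₀ (hFk.le.trans hkj₀)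
    rw [hFk] at this
    exact h6.trans this
  have hsum : ∀ φ ∈ W0 Ω₁ σ, |act φ (∑ i ∈ F, x i)| ≤ normOf G0 (∑ i ∈ F, x i) := by
    intro φ hφ
    rcases mem_W0_cases hφ with h | ⟨j, s, A, hj, hs, h⟩
    · exact abs_act_le_normOf_G0 h _
    · have hm4 : (4 : ℝ) ≤ m (2 * j + 1) := by
        have h1 : 2 ^ 2 ≤ m (2 * j + 1) :=
          (Nat.pow_le_pow_right two_pos (by omega)).trans (two_pow_le_m _)
        exact_mod_cast h1
      have hm0 : (0 : ℝ) < m (2 * j + 1) := by linarith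
      have habs : ∀ y, |act φ y| = (m (2 * j + 1) : ℝ)⁻¹ * |act (cut A s.sum) y| := by
        intro y
        rcases h with rfl | rfl
        · rw [map_smul, act_smul_left, abs_mul, abs_of_pos (inv_pos.2 hm0)]
        · rw [act_neg_left, abs_neg, map_smul, act_smul_left, abs_mul, abs_of_pos (inv_pos.2 hm0)]
      have hle := hL F hF hFk j s A hs (m (2 * j + 1)) fun i => by
        have h1 := (abs_act_le_normOf_W0 hφ (x i)).trans (hnorm i).2.2
        rwa [habs, inv_mul_le_iff₀ hm0, mul_one] at h1
      rw [habs, inv_mul_le_iff₀ hm0]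
      -- With M = `m (2 * j + 1)` ≥ 4 and S the G₀-norm of the sum, S ≥ 6: (M − 2)S ≥ 6(M − 2) ≥ 2M
      -- + 4, with equality at M = 4, S = 6.
      nlinarith
  have hk' : (0 : ℝ) < (k : ℝ)⁻¹ := inv_pos.2 (by exact_mod_cast hkpos)
  have hbound : ∀ φ ∈ W0 Ω₁ σ, |act φ ((k : ℝ)⁻¹ • ∑ i ∈ F, x i)| ≤
      normOf G0 ((k : ℝ)⁻¹ • ∑ i ∈ F, x i) := by
    intro φ hφ
    rw [act_smul_right, abs_mul, abs_of_pos hk', ← le_div_iff₀' hk']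
    refine (hsum φ hφ).trans (csSup_le (Set.Nonempty.image _ ⟨0, zero_mem_G0⟩) ?_)
    rintro _ ⟨f, hf, rfl⟩
    rw [le_div_iff₀' hk']
    have := abs_act_le_normOf_G0 hf ((k : ℝ)⁻¹ • ∑ i ∈ F, x i)
    rwa [act_smul_right, abs_mul, abs_of_pos hk'] at this
  refine ⟨fun φ hφ => (le_abs_self _).trans (hbound φ hφ.1), le_antisymm ?_ ?_⟩
  · refine csSup_le (Set.Nonempty.image _ ⟨0, G0_subset_W0 _ _ zero_mem_G0⟩) ?_
    rintro _ ⟨φ, hφ, rfl⟩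
    exact hbound φ hφ
  · exact csSup_le_csSup (bddAbove_act_W0 Ω₁ σ _) (Set.Nonempty.image _ ⟨0, zero_mem_G0⟩)
      (Set.image_mono (G0_subset_W0 _ _))
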